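/- Let $n\ge 0$, $X=\mathbb{R}^n$, and let $R$ be a coefficient ring. A function $f:X\to\mathbb{R}$ is called quadratic at infinity if it is continuous and coincides, outside a compact set, with a nondegenerate quadratic form $Q$ on $X$; let $\lambda$ be the Morse index of $Q$ (the maximal dimension of a subspace on which $Q$ is negative definite). Put $f^c=\{x\in X: f(x)\le c\}$, and write $f^{\infty}=f^{N}$, $f^{-\infty}=f^{-N}$ for $N$ large enough (the choice does not matter). With singular homology, let \[ i_{c*}:H_\lambda(f^c,f^{-\infty};R)\to H_\lambda(f^{\infty},f^{-\infty};R), \] \[ j_{c*}:H_{n-\lambda}(X\setminus f^c,X\setminus f^{\infty};R)\to H_{n-\lambda}(X\setminus f^{-\infty},X\setminus f^{\infty};R) \] be the maps induced by inclusion, and define the minmax and the maxmin of $f$ by \[ m(f,R)=\inf\{c\in\mathbb{R}: i_{c*}\text{ is surjective}\},\qquad s(f,R)=\sup\{c\in\mathbb{R}: j_{c*}\text{ is surjective}\} \] (infimum and supremum in $[-\infty,+\infty]$). If $f$ is locally Lipschitz and quadratic at infinity, then \[ s(f,R)=-m(-f,R). \] -/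

import Mathlib

open CategoryTheory

universe u

namespace MinMax

/-! ### Relative singular homology of pairs -/

/-- The relative singular homology functor `(A, B) ↦ H_k(A, B; R)` on topological pairs: the
`k`-th homology of the quotient `C_*(A; R) / C_*(B; R)` of singular chain complexes. -/
noncomputable def relHomology (R : Type u) [Ring R] (k : ℕ) : TopPair.{0} ⥤ ModuleCat.{u} R :=
  MorphismProperty.Arrow.forget _ _ _ ⋙
    ((AlgebraicTopology.singularChainComplexFunctor (ModuleCat.{u} R)).obj
      (ModuleCat.of R R)).mapArrow ⋙
    Limits.coker (ChainComplex (ModuleCat.{u} R) ℕ) ⋙ HomologicalComplex.homologyFunctor _ _ k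

/-- The topological pair `(A, B)` given by subsets `B ⊆ A` of a space `X`. -/
def setPair {X : Type} [TopologicalSpace X] {A B : Set X} (h : B ⊆ A) : TopPair.{0} :=
  TopPair.of (A := TopCat.of B) (X := TopCat.of A)
    (TopCat.ofHom ⟨Set.inclusion h, continuous_inclusion h⟩) (Topology.IsEmbedding.inclusion h)

/-- The inclusion of pairs `(A, B) ↪ (A', B')`. -/
def setPairIncl {X : Type} [TopologicalSpace X] {A B A' B' : Set X} {h : B ⊆ A} {h' : B' ⊆ A'}
    (hA : A ⊆ A') (hB : B ⊆ B') : setPair h ⟶ setPair h' :=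
  TopPair.ofHom (X := setPair h) (Y := setPair h')
    (TopCat.ofHom ⟨Set.inclusion hA, continuous_inclusion hA⟩)
    (TopCat.ofHom ⟨Set.inclusion hB, continuous_inclusion hB⟩) rfl

/-- The map `H_k(A, B; R) → H_k(A', B'; R)` induced by the inclusion `(A, B) ↪ (A', B')`. -/
noncomputable def inclHomology (R : Type u) [Ring R] (k : ℕ) {X : Type} [TopologicalSpace X]
    {A B A' B' : Set X} (h : B ⊆ A) (h' : B' ⊆ A') (hA : A ⊆ A') (hB : B ⊆ B') :
    (relHomology R k).obj (setPair h) →ₗ[R] (relHomology R k).obj (setPair h') :=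
  ((relHomology R k).map (setPairIncl hA hB)).hom

/-! ### Functions quadratic at infinity -/

/-- `Q` is a nondegenerate quadratic form with which `f` coincides outside a compact set. -/
def IsReferenceForm {n : ℕ} (f : EuclideanSpace ℝ (Fin n) → ℝ)
    (Q : QuadraticForm ℝ (EuclideanSpace ℝ (Fin n))) : Prop :=
  Q.Nondegenerate ∧ ∃ K : Set (EuclideanSpace ℝ (Fin n)), IsCompact K ∧ ∀ x ∉ K, f x = Q x

/-- `f` is continuous and coincides with a nondegenerate quadratic form outside a compact set. -/
def QuadraticAtInfinity {n : ℕ} (f : EuclideanSpace ℝ (Fin n) → ℝ) : Prop :=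
  Continuous f ∧ ∃ Q, IsReferenceForm f Q

/-- The reference quadratic form is determined by the function. -/
theorem IsReferenceForm.unique {n : ℕ} {f : EuclideanSpace ℝ (Fin n) → ℝ}
    {Q Q' : QuadraticForm ℝ (EuclideanSpace ℝ (Fin n))}
    (h : IsReferenceForm f Q) (h' : IsReferenceForm f Q') : Q = Q' := by
  obtain ⟨-, K, hK, hKQ⟩ := h
  obtain ⟨-, K', hK', hKQ'⟩ := h'
  ext x
  by_cases hx : x = 0
  · simp [hx]
  obtain ⟨r, hr⟩ := (hK.union hK').isBounded.exists_norm_le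
  have hxn : 0 < ‖x‖ := norm_pos_iff.mpr hx
  set t : ℝ := (|r| + 1) / ‖x‖ with ht
  have htpos : 0 < t := by positivity
  have hnot : t • x ∉ K ∪ K' := by
    intro hmem
    have h1 := hr _ hmem
    rw [norm_smul, Real.norm_of_nonneg htpos.le, ht, div_mul_cancel₀ _ hxn.ne'] at h1
    linarith [le_abs_self r]
  have e : Q (t • x) = Q' (t • x) := by
    rw [← hKQ _ fun hm => hnot (Or.inl hm), ← hKQ' _ fun hm => hnot (Or.inr hm)]
  rw [QuadraticMap.map_smul, QuadraticMap.map_smul, smul_eq_mul, smul_eq_mul] at e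
  exact mul_left_cancel₀ (mul_pos htpos htpos).ne' e

open Classical in
/-- The Morse index `λ` of the reference quadratic form of `f`, i.e. the maximal dimension of a
subspace on which that form is negative definite. The value is `0` if `f` has no reference form. -/
noncomputable def indexAtInfinity {n : ℕ} (f : EuclideanSpace ℝ (Fin n) → ℝ) : ℕ :=
  if h : ∃ Q, IsReferenceForm f Q then sigNeg h.choose else 0

theorem IsReferenceForm.indexAtInfinity_eq {n : ℕ} {f : EuclideanSpace ℝ (Fin n) → ℝ}
    {Q : QuadraticForm ℝ (EuclideanSpace ℝ (Fin n))} (h : IsReferenceForm f Q) :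
    indexAtInfinity f = sigNeg Q := by
  have hex : ∃ Q, IsReferenceForm f Q := ⟨Q, h⟩
  rw [indexAtInfinity, dif_pos hex, hex.choose_spec.unique h]

/-! ### Sublevel sets, minmax and maxmin -/

/-- The sublevel set `f^c = {x | f x ≤ c}`. -/
def sublevel {X : Type} (f : X → ℝ) (c : ℝ) : Set X := {x | f x ≤ c}

theorem sublevel_mono {X : Type} (f : X → ℝ) {a b : ℝ} (h : a ≤ b) :
    sublevel f a ⊆ sublevel f b :=
  fun _ hx => le_trans hx h

theorem compl_sublevel_anti {X : Type} (f : X → ℝ) {a b : ℝ} (h : a ≤ b) :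
    (sublevel f b)ᶜ ⊆ (sublevel f a)ᶜ :=
  Set.compl_subset_compl.mpr (sublevel_mono f h)

/-- The map `i_{c*} : H_k(f^c, f^{-N}; R) → H_k(f^N, f^{-N}; R)`. -/
noncomputable def iMap (R : Type u) [Ring R] (k : ℕ) {X : Type} [TopologicalSpace X] (f : X → ℝ)
    {c N : ℝ} (h₁ : -N ≤ c) (h₂ : c ≤ N) :
    (relHomology R k).obj (setPair (sublevel_mono f h₁)) →ₗ[R]
      (relHomology R k).obj (setPair (sublevel_mono f (h₁.trans h₂))) :=
  inclHomology R k _ _ (sublevel_mono f h₂) subset_rfl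

/-- The map `j_{c*} : H_k(X ∖ f^c, X ∖ f^N; R) → H_k(X ∖ f^{-N}, X ∖ f^N; R)`. -/
noncomputable def jMap (R : Type u) [Ring R] (k : ℕ) {X : Type} [TopologicalSpace X] (f : X → ℝ)
    {c N : ℝ} (h₁ : -N ≤ c) (h₂ : c ≤ N) :
    (relHomology R k).obj (setPair (compl_sublevel_anti f h₂)) →ₗ[R]
      (relHomology R k).obj (setPair (compl_sublevel_anti f (h₁.trans h₂))) :=
  inclHomology R k _ _ (compl_sublevel_anti f h₁) subset_rfl

/-- The minmax `m(f, R)`: the infimum of the real numbers `c` such that `i_{c*}` maps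
`H_λ(f^c, f^{-∞}; R)` onto `H_λ(f^∞, f^{-∞}; R)`. Here `f^{±∞}` stands for `f^{±N}` with `N` large
enough. The infimum is taken in the extended reals, so that it carries no default value. -/
noncomputable def minmax {n : ℕ} (f : EuclideanSpace ℝ (Fin n) → ℝ) (R : Type u) [Ring R] :
    EReal :=
  sInf (Real.toEReal '' {c : ℝ | ∀ᶠ N : ℝ in Filter.atTop, ∃ (h₁ : -N ≤ c) (h₂ : c ≤ N),
    Function.Surjective (iMap R (indexAtInfinity f) f h₁ h₂)})

/-- The maxmin `s(f, R)`: the supremum of the real numbers `c` such that `j_{c*}` maps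
`H_{n-λ}(X ∖ f^c, X ∖ f^∞; R)` onto `H_{n-λ}(X ∖ f^{-∞}, X ∖ f^∞; R)`, where `X = ℝⁿ`. Here
`f^{±∞}` stands for `f^{±N}` with `N` large enough. The supremum is taken in the extended reals,
so that it carries no default value. -/
noncomputable def maxmin {n : ℕ} (f : EuclideanSpace ℝ (Fin n) → ℝ) (R : Type u) [Ring R] :
    EReal :=
  sSup (Real.toEReal '' {c : ℝ | ∀ᶠ N : ℝ in Filter.atTop, ∃ (h₁ : -N ≤ c) (h₂ : c ≤ N),
    Function.Surjective (jMap R (n - indexAtInfinity f) f h₁ h₂)})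

end MinMax

/-! The complement of `f^c` is the open sublevel set `{-f < -c}`, and `-Q` has index `n - λ`, so
`j_{c*}` for `f` is the map `i_{-c*}` for `-f` built from open instead of closed sublevel sets
(`surjective_jMap_iff`). It remains to see that open and closed sublevel sets give the same infimum.
Near `±∞` the two kinds are interchangeable: at large levels the sublevel sets of `f` are those of
`Q`, and the rescaling `x ↦ exp (-s Q(x)) x` deforms one pair into the other
(`bijective_inclHomology_of_quadraticForm`). At the middle level inclusions suffice: `{f < c} ⊆ f^c`
passes surjectivity from open to closed at the same `c`, and `f^c ⊆ {f < c'}` passes it from closed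
to open for every `c' > c`. No deformation of `f` at intermediate levels is needed. -/

/-! ### Homotopy invariance of relative singular homology -/

open MonoidalCategory Simplicial Opposite in
lemma SSet.Homotopy.toSimplicialObjectHomotopy_h_naturality {A B X Y : SSet.{u}} {f g : X ⟶ Y}
    {f' g' : A ⟶ B} (H : SSet.Homotopy f g) (H' : SSet.Homotopy f' g') (a : A ⟶ X) (b : B ⟶ Y)
    (w : a ▷ Δ[1] ≫ H.h = H'.h ≫ b) {p : ℕ} (i : Fin (p + 1)) :
    H'.toSimplicialObjectHomotopy.h i ≫ b.app (op ⦋p + 1⦌) =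
      a.app (op ⦋p⦌) ≫ H.toSimplicialObjectHomotopy.h i := by
  ext x
  -- By Yoneda a simplex is a map from `Δ[p]`; the prism operators evaluate the homotopy on
  -- simplices of `Δ[p] ⊗ Δ[1]`, so naturality can be checked there.
  have hx : SSet.yonedaEquiv.symm (a.app (op ⦋p⦌) x) = SSet.yonedaEquiv.symm x ≫ a := by
    apply SSet.yonedaEquiv.injective
    simp
  have key : SSet.yonedaEquiv.symm (a.app (op ⦋p⦌) x) ▷ Δ[1] ≫ H.h =
      (SSet.yonedaEquiv.symm x ▷ Δ[1] ≫ H'.h) ≫ b := by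
    rw [hx, comp_whiskerRight, Category.assoc, w, Category.assoc]
  exact (ConcreteCategory.congr_hom (NatTrans.congr_app key _) _).symm

open MonoidalCategory Simplicial Functor.LaxMonoidal in
lemma TopPair.Homotopy.toSSet_w {X Y : TopPair.{u}} {f g : X ⟶ Y} (F : TopPair.Homotopy f g) :
    TopCat.toSSet.map X.map ▷ Δ[1] ≫ F.fst.toSSet.h =
      F.snd.toSSet.h ≫ TopCat.toSSet.map Y.map := by
  dsimp only [TopCat.Homotopy.toSSet]
  rw [Category.assoc, Category.assoc, ← Functor.map_comp, ← F.w, Functor.map_comp,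
    ← whisker_exchange_assoc, μ_natural_left_assoc]

lemma CategoryTheory.SimplicialObject.Homotopy.toChainHomotopy_hom_naturality {C : Type*}
    [Category* C] [Preadditive C] {A B X Y : SimplicialObject C} {f g : X ⟶ Y} {f' g' : A ⟶ B}
    (H : SimplicialObject.Homotopy f g) (H' : SimplicialObject.Homotopy f' g')
    (a : A ⟶ X) (b : B ⟶ Y)
    (w : ∀ {p : ℕ} (i : Fin (p + 1)), H'.h i ≫ b.app _ = a.app _ ≫ H.h i) (p q : ℕ) :
    H'.toChainHomotopy.hom p q ≫ ((AlgebraicTopology.alternatingFaceMapComplex C).map b).f q =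
      ((AlgebraicTopology.alternatingFaceMapComplex C).map a).f p ≫ H.toChainHomotopy.hom p q := by
  by_cases h : p + 1 = q
  · subst h
    dsimp only [toChainHomotopy]
    rw [ToChainHomotopy.hom_eq, ToChainHomotopy.hom_eq]
    simp only [AlgebraicTopology.alternatingFaceMapComplex_map_f, Preadditive.neg_comp,
      Preadditive.comp_neg, Preadditive.sum_comp, Preadditive.comp_sum, Preadditive.zsmul_comp,
      Preadditive.comp_zsmul, w]
  · rw [H'.toChainHomotopy.zero _ _ h, H.toChainHomotopy.zero _ _ h]
    simp

open Limits in
lemma HomologicalComplex.cokernel_π_f_hom_ext {C : Type*} [Category* C] [Abelian C] {ι : Type*}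
    {c : ComplexShape ι} {K L : HomologicalComplex C c} (φ : K ⟶ L) (i : ι) {T : C}
    {u v : (cokernel φ).X i ⟶ T} (h : (cokernel.π φ).f i ≫ u = (cokernel.π φ).f i ≫ v) : u = v := by
  have : Epi ((cokernel.π φ).f i) := inferInstanceAs (Epi ((eval C c i).map (cokernel.π φ)))
  exact (cancel_epi _).mp h

open Limits in
/-- `(coker φ)_i` is the cokernel of `φ_i`. -/
noncomputable def HomologicalComplex.cokernelFDesc {C : Type*} [Category* C] [Abelian C]
    {ι : Type*} {c : ComplexShape ι} {K L : HomologicalComplex C c} (φ : K ⟶ L) (i : ι) {T : C}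
    (u : L.X i ⟶ T) (h : φ.f i ≫ u = 0) : (cokernel φ).X i ⟶ T :=
  (CokernelCofork.mapIsColimit _ (cokernelIsCokernel φ) (eval C c i)).desc
    (CokernelCofork.ofπ u h)

open Limits in
lemma HomologicalComplex.π_f_cokernelFDesc {C : Type*} [Category* C] [Abelian C]
    {ι : Type*} {c : ComplexShape ι} {K L : HomologicalComplex C c} (φ : K ⟶ L) (i : ι) {T : C}
    (u : L.X i ⟶ T) (h : φ.f i ≫ u = 0) :
    (cokernel.π φ).f i ≫ cokernelFDesc φ i u h = u :=
  (CokernelCofork.mapIsColimit _ (cokernelIsCokernel φ) (eval C c i)).fac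
    (CokernelCofork.ofπ u h) WalkingParallelPair.one

open Limits HomologicalComplex in
/-- Compatible chain homotopies between maps of arrows of chain complexes descend to the
cokernels. -/
noncomputable def Homotopy.cokernelMap {C : Type*} [Category* C] [Abelian C] {ι : Type*}
    {c : ComplexShape ι} {K L K' L' : HomologicalComplex C c} (φ : K ⟶ L) (φ' : K' ⟶ L')
    {f g : K ⟶ K'} {f' g' : L ⟶ L'} (wf : φ ≫ f' = f ≫ φ') (wg : φ ≫ g' = g ≫ φ')
    (h : Homotopy f g) (h' : Homotopy f' g')
    (w : ∀ i j, φ.f i ≫ h'.hom i j = h.hom i j ≫ φ'.f j) :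
    Homotopy (cokernel.map φ φ' f f' wf) (cokernel.map φ φ' g g' wg) where
  hom i j := cokernelFDesc φ i (h'.hom i j ≫ (cokernel.π φ').f j) (by
    rw [← Category.assoc, w, Category.assoc, ← comp_f, cokernel.condition]
    simp)
  zero i j hij := by
    apply cokernel_π_f_hom_ext
    rw [π_f_cokernelFDesc, h'.zero i j hij]
    simp
  comm i := by
    apply cokernel_π_f_hom_ext
    have e₁ (u : L ⟶ L') (v : K ⟶ K') (hw : φ ≫ u = v ≫ φ') :
        (cokernel.π φ).f i ≫ (cokernel.map φ φ' v u hw).f i = u.f i ≫ (cokernel.π φ').f i := by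
      rw [← comp_f, cokernel.π_desc, comp_f]
    rw [e₁, Preadditive.comp_add, Preadditive.comp_add, e₁, h'.comm i, Preadditive.add_comp,
      Preadditive.add_comp]
    congr 2
    · change (L.d i _ ≫ h'.hom _ i) ≫ _ = _ ≫ (cokernel φ).d i _ ≫ cokernelFDesc φ _ _ _
      rw [Hom.comm_assoc, π_f_cokernelFDesc, Category.assoc]
    · change (h'.hom i _ ≫ L'.d _ i) ≫ _ = _ ≫ cokernelFDesc φ _ _ _ ≫ (cokernel φ').d _ i
      rw [← Category.assoc _ _ ((cokernel φ').d _ i), π_f_cokernelFDesc, Category.assoc,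
        Category.assoc, Hom.comm]

/-- Homotopy invariance of relative singular homology. -/
theorem MinMax.relHomology_map_eq_of_homotopy (R : Type u) [Ring R] (k : ℕ) {X Y : TopPair.{0}}
    {f g : X ⟶ Y} (F : TopPair.Homotopy f g) :
    (relHomology R k).map f = (relHomology R k).map g := by
  let S := (AlgebraicTopology.singularChainComplexFunctor.{0} (ModuleCat.{u} R)).obj (ModuleCat.of R R)
  have hw (f : X ⟶ Y) : S.map X.map ≫ S.map (TopPair.Hom.fst f) =
      S.map (TopPair.Hom.snd f) ≫ S.map Y.map := by
    rw [← S.map_comp, ← S.map_comp, TopPair.Hom.w]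
  let h := F.snd.singularChainComplexFunctorObjMap (ModuleCat.of R R)
  let h' := F.fst.singularChainComplexFunctorObjMap (ModuleCat.of R R)
  have H := Homotopy.cokernelMap _ _ (hw f) (hw g) h h' (by
    intro i j
    symm
    refine SimplicialObject.Homotopy.toChainHomotopy_hom_naturality _ _ _ _ ?_ i j
    intro p i
    have := SSet.Homotopy.toSimplicialObjectHomotopy_h_naturality _ _ _ _ F.toSSet_w i
    -- Singular chains in each degree are `G` of the set of simplices, so the identity between prism
    -- operators on sets carries over.
    let G : Type ⥤ ModuleCat.{u} R := Limits.sigmaConst.obj (ModuleCat.of R R)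
    exact (G.map_comp _ _).symm.trans ((congrArg G.map this).trans (G.map_comp _ _)))
  exact H.homologyMap_eq k

namespace MinMax

/-! ### Deformations of pairs of subsets -/

section Pairs

variable {X : Type} [TopologicalSpace X]

/-- The map of pairs `(A, B) ⟶ (A', B')` that a self-map of the ambient space induces. -/
def setPairMap {A B A' B' : Set X} (h : B ⊆ A) (h' : B' ⊆ A') (φ : C(X, X))
    (hA : Set.MapsTo φ A A') (hB : Set.MapsTo φ B B') : setPair h ⟶ setPair h' :=
  TopPair.ofHom (X := setPair h) (Y := setPair h')
    (TopCat.ofHom ⟨hA.restrict, φ.continuous.restrict hA⟩)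
    (TopCat.ofHom ⟨hB.restrict, φ.continuous.restrict hB⟩) rfl

/-- A homotopy of self-maps of the ambient space that respects the subsets induces a homotopy of
maps of pairs. -/
def setPairHomotopy {A B A' B' : Set X} (h : B ⊆ A) (h' : B' ⊆ A') {φ ψ : C(X, X)}
    (F : φ.Homotopy ψ) (hA : ∀ t, Set.MapsTo (fun x => F (t, x)) A A')
    (hB : ∀ t, Set.MapsTo (fun x => F (t, x)) B B')
    (hφA : Set.MapsTo φ A A') (hφB : Set.MapsTo φ B B')
    (hψA : Set.MapsTo ψ A A') (hψB : Set.MapsTo ψ B B') :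
    TopPair.Homotopy (setPairMap h h' φ hφA hφB) (setPairMap h h' ψ hψA hψB) where
  fst :=
    { toFun p := ⟨F (p.1, p.2.1), hA p.1 p.2.2⟩
      continuous_toFun := by
        refine Continuous.subtype_mk (F.continuous.comp ?_) _
        exact continuous_fst.prodMk (continuous_subtype_val.comp continuous_snd)
      map_zero_left x := Subtype.ext (F.map_zero_left x.1)
      map_one_left x := Subtype.ext (F.map_one_left x.1) }
  snd :=
    { toFun p := ⟨F (p.1, p.2.1), hB p.1 p.2.2⟩
      continuous_toFun := by
        refine Continuous.subtype_mk (F.continuous.comp ?_) _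
        exact continuous_fst.prodMk (continuous_subtype_val.comp continuous_snd)
      map_zero_left x := Subtype.ext (F.map_zero_left x.1)
      map_one_left x := Subtype.ext (F.map_one_left x.1) }
  w := rfl

variable (R : Type u) [Ring R] (k : ℕ)

lemma inclHomology_comp {A B A' B' A'' B'' : Set X} (h : B ⊆ A) (h' : B' ⊆ A') (h'' : B'' ⊆ A'')
    (hA : A ⊆ A') (hB : B ⊆ B') (hA' : A' ⊆ A'') (hB' : B' ⊆ B'')
    (x : (relHomology R k).obj (setPair h)) :
    inclHomology R k h' h'' hA' hB' (inclHomology R k h h' hA hB x) =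
      inclHomology R k h h'' (hA.trans hA') (hB.trans hB') x := by
  have e : setPairIncl (h := h) (h' := h'') (hA.trans hA') (hB.trans hB') =
      setPairIncl hA hB ≫ setPairIncl (h := h') hA' hB' := rfl
  simp only [inclHomology, e, Functor.map_comp]
  rfl

lemma surjective_inclHomology_congr {A B A' B' A₁ B₁ A₁' B₁' : Set X} (h : B ⊆ A) (h' : B' ⊆ A')
    (hA : A ⊆ A') (hB : B ⊆ B') (h₁ : B₁ ⊆ A₁) (h₁' : B₁' ⊆ A₁') (hA₁ : A₁ ⊆ A₁')
    (hB₁ : B₁ ⊆ B₁') (eA : A = A₁) (eB : B = B₁) (eA' : A' = A₁') (eB' : B' = B₁') :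
    Function.Surjective (inclHomology R k h h' hA hB) ↔
      Function.Surjective (inclHomology R k h₁ h₁' hA₁ hB₁) := by
  subst eA eB eA' eB'
  rfl

/-- If a deformation of the ambient space preserves two nested pairs and pushes the larger one into
the smaller one, then the inclusion induces an isomorphism on relative homology. -/
theorem bijective_inclHomology_of_deformation {A B A' B' : Set X} (h : B ⊆ A) (h' : B' ⊆ A')
    (hA : A ⊆ A') (hB : B ⊆ B') {ψ : C(X, X)} (F : (ContinuousMap.id X).Homotopy ψ)
    (hFA : ∀ t, Set.MapsTo (fun x => F (t, x)) A A)
    (hFB : ∀ t, Set.MapsTo (fun x => F (t, x)) B B)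
    (hFA' : ∀ t, Set.MapsTo (fun x => F (t, x)) A' A')
    (hFB' : ∀ t, Set.MapsTo (fun x => F (t, x)) B' B')
    (hψA : Set.MapsTo ψ A' A) (hψB : Set.MapsTo ψ B' B) :
    Function.Bijective (inclHomology R k h h' hA hB) := by
  let r : setPair h' ⟶ setPair h := setPairMap h' h ψ hψA hψB
  let i : setPair h ⟶ setPair h' := setPairIncl hA hB
  -- The same deformation, restricted to each pair, makes `r` a two-sided homotopy inverse of the
  -- inclusion.
  have e₁ : (relHomology R k).map (𝟙 (setPair h)) = (relHomology R k).map (i ≫ r) :=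
    relHomology_map_eq_of_homotopy R k (setPairHomotopy h h F hFA hFB (Set.mapsTo_id _)
      (Set.mapsTo_id _) (hψA.mono_left hA) (hψB.mono_left hB))
  have e₂ : (relHomology R k).map (𝟙 (setPair h')) = (relHomology R k).map (r ≫ i) :=
    relHomology_map_eq_of_homotopy R k (setPairHomotopy h' h' F hFA' hFB' (Set.mapsTo_id _)
      (Set.mapsTo_id _) (hψA.mono_right hA) (hψB.mono_right hB))
  rw [CategoryTheory.Functor.map_id, Functor.map_comp] at e₁ e₂
  have : IsIso ((relHomology R k).map i) := ⟨_, e₁.symm, e₂.symm⟩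
  exact ConcreteCategory.bijective_of_isIso ((relHomology R k).map i)

end Pairs

/-! ### Deforming sublevel sets of a quadratic form -/

section QuadraticForm

variable {E : Type} [NormedAddCommGroup E] [NormedSpace ℝ E]

lemma quadraticForm_exp_smul (Q : QuadraticForm ℝ E) (a : ℝ) (x : E) :
    Q (Real.exp (-a) • x) = Real.exp (-(2 * a)) * Q x := by
  rw [QuadraticMap.map_smul, smul_eq_mul, ← Real.exp_add]
  ring_nf

variable [FiniteDimensional ℝ E]

lemma continuous_quadraticForm (Q : QuadraticForm ℝ E) : Continuous Q := by
  have h (x : E) : Q x = (LinearMap.toContinuousBilinearMap (QuadraticMap.associated Q)) x x :=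
    (QuadraticMap.associated_eq_self_apply ℝ Q x).symm
  rw [funext h]
  fun_prop

/-- The deformation `x ↦ exp (-t s Q(x)) x`, which decreases `Q` for `s ≥ 0`. -/
noncomputable def quadraticDescent (Q : QuadraticForm ℝ E) (s : ℝ) :
    (ContinuousMap.id E).Homotopy
      ⟨fun x => Real.exp (-(s * Q x)) • x, by have := continuous_quadraticForm Q; fun_prop⟩ where
  toFun p := Real.exp (-(p.1 * (s * Q p.2))) • p.2
  continuous_toFun := by have := continuous_quadraticForm Q; fun_prop
  map_zero_left x := by simp
  map_one_left x := by simp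

lemma exp_neg_mul_self_mul_le {a q : ℝ} (ha : 0 ≤ a) : Real.exp (-(a * q)) * q ≤ q := by
  rcases le_total 0 q with hq | hq
  · exact mul_le_of_le_one_left hq (Real.exp_le_one_iff.mpr (by nlinarith))
  · have : 1 ≤ Real.exp (-(a * q)) := Real.one_le_exp (by nlinarith)
    nlinarith

/-- From `exp u > u` with `u = a q`. The bound is uniform in `q`, so one rescaling brings all of
space below a small positive level. -/
lemma exp_neg_mul_self_mul_lt_inv {a : ℝ} (ha : 0 < a) (q : ℝ) :
    Real.exp (-(a * q)) * q < a⁻¹ := by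
  rw [Real.exp_neg, inv_mul_eq_div, div_lt_iff₀ (Real.exp_pos _), ← div_eq_inv_mul, lt_div_iff₀ ha]
  linarith [Real.add_one_le_exp (a * q)]

/-- From `exp u ≥ 1 + u` with `u = -a q`. For large `a`, points at level at most `-δ < 0` sink below
any prescribed level. -/
lemma exp_neg_mul_self_mul_le_neg {a q δ : ℝ} (ha : 0 < a) (hδ : 0 ≤ δ) (hq : q ≤ -δ) :
    Real.exp (-(a * q)) * q ≤ -(a * δ ^ 2) := by
  have h₁ := Real.add_one_le_exp (-(a * q))
  have h₂ : (-(a * q)) * (-q) ≤ Real.exp (-(a * q)) * (-q) :=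
    mul_le_mul_of_nonneg_right (by linarith) (by linarith)
  have h₃ : δ ^ 2 ≤ q ^ 2 := by nlinarith
  nlinarith

/-- Inclusions between pairs of sublevel sets of a quadratic form, with the larger sets above a
positive level and the smaller ones below a negative level, are isomorphisms on homology. -/
theorem bijective_inclHomology_of_quadraticForm (R : Type u) [Ring R] (k : ℕ)
    (Q : QuadraticForm ℝ E) {A B A' B' : Set E} (h : B ⊆ A) (h' : B' ⊆ A')
    (hA : A ⊆ A') (hB : B ⊆ B')
    (lA : ∀ ⦃x y⦄, Q y ≤ Q x → x ∈ A → y ∈ A) (lB : ∀ ⦃x y⦄, Q y ≤ Q x → x ∈ B → y ∈ B)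
    (lA' : ∀ ⦃x y⦄, Q y ≤ Q x → x ∈ A' → y ∈ A') (lB' : ∀ ⦃x y⦄, Q y ≤ Q x → x ∈ B' → y ∈ B')
    {ε δ M : ℝ} (hε : 0 < ε) (hεA : ∀ x, Q x < ε → x ∈ A) (hδ : 0 < δ)
    (hδB' : ∀ x ∈ B', Q x ≤ -δ) (hMB : ∀ x, Q x ≤ -M → x ∈ B) :
    Function.Bijective (inclHomology R k h h' hA hB) := by
  -- At time 1 the value `q` of `Q` becomes `exp (-2 s q) q`: the first bound on `s` sends
  -- everything into `A`, the second sends `B'` into `B`.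
  obtain ⟨s, hs, hsε, hsM⟩ : ∃ s : ℝ, 0 < s ∧ (2 * s)⁻¹ ≤ ε ∧ M ≤ 2 * s * δ ^ 2 := by
    refine ⟨max (ε⁻¹ / 2) (M / (2 * δ ^ 2)), lt_max_of_lt_left (by positivity), ?_, ?_⟩
    · apply inv_le_of_inv_le₀ hε
      linarith [le_max_left (ε⁻¹ / 2) (M / (2 * δ ^ 2))]
    · have := le_max_right (ε⁻¹ / 2) (M / (2 * δ ^ 2))
      rw [div_le_iff₀ (by positivity)] at this
      linarith
  have hdec (t : unitInterval) (x : E) : Q (quadraticDescent Q s (t, x)) ≤ Q x := by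
    change Q (Real.exp (-(t * (s * Q x))) • x) ≤ Q x
    rw [quadraticForm_exp_smul, show 2 * ((t : ℝ) * (s * Q x)) = (2 * t * s) * Q x by ring]
    exact exp_neg_mul_self_mul_le (by have := t.2.1; positivity)
  have hend (x : E) : Q (Real.exp (-(s * Q x)) • x) = Real.exp (-(2 * s * Q x)) * Q x := by
    rw [quadraticForm_exp_smul, mul_assoc]
  refine bijective_inclHomology_of_deformation R k h h' hA hB (quadraticDescent Q s)
    (fun t x hx => lA (hdec t x) hx) (fun t x hx => lB (hdec t x) hx)
    (fun t x hx => lA' (hdec t x) hx) (fun t x hx => lB' (hdec t x) hx) ?_ ?_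
  · intro x _
    refine hεA _ ?_
    change Q (Real.exp (-(s * Q x)) • x) < ε
    rw [hend]
    exact (exp_neg_mul_self_mul_lt_inv (by positivity) _).trans_le hsε
  · intro x hx
    refine hMB _ ?_
    change Q (Real.exp (-(s * Q x)) • x) ≤ -M
    rw [hend]
    exact (exp_neg_mul_self_mul_le_neg (by positivity) hδ.le (hδB' x hx)).trans (by linarith)

end QuadraticForm

/-! ### Reference forms -/

section ReferenceForm

variable {n : ℕ} {f : EuclideanSpace ℝ (Fin n) → ℝ}
  {Q : QuadraticForm ℝ (EuclideanSpace ℝ (Fin n))}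

lemma IsReferenceForm.neg (h : IsReferenceForm f Q) : IsReferenceForm (-f) (-Q) := by
  obtain ⟨hQ, K, hK, hfK⟩ := h
  have : Invertible (2 : ℝ) := invertibleOfNonzero two_ne_zero
  refine ⟨?_, K, hK, fun x hx => by simp [hfK x hx]⟩
  rw [QuadraticMap.nondegenerate_iff_radical_eq_bot] at hQ ⊢
  rw [← hQ]
  ext x
  simp [QuadraticMap.mem_radical_iff']

/-- Sylvester's law: the radical is zero, so the positive and negative indices add up to `n`, and
negation swaps them. -/
lemma IsReferenceForm.indexAtInfinity_neg (h : IsReferenceForm f Q) :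
    indexAtInfinity (-f) = n - indexAtInfinity f := by
  have hs := QuadraticForm.sigPos_add_sigNeg_add_radical (Q := Q)
  rw [h.1.radical_eq_bot, finrank_bot, finrank_euclideanSpace_fin] at hs
  rw [h.neg.indexAtInfinity_eq, h.indexAtInfinity_eq, sigNeg_neg]
  omega

/-- Beyond some level, the sublevel sets of `f` and of its reference form agree. -/
lemma IsReferenceForm.exists_level (h : IsReferenceForm f Q) (hf : Continuous f) :
    ∃ M : ℝ, 0 ≤ M ∧ ∀ c, M < |c| → ∀ x, (f x ≤ c ↔ Q x ≤ c) ∧ (f x < c ↔ Q x < c) := by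
  obtain ⟨-, K, hK, hfK⟩ := h
  obtain ⟨M₁, h₁⟩ := hK.exists_bound_of_continuousOn hf.continuousOn
  obtain ⟨M₂, h₂⟩ := hK.exists_bound_of_continuousOn (continuous_quadraticForm Q).continuousOn
  refine ⟨max 0 (max M₁ M₂), le_max_left _ _, fun c hc x => ?_⟩
  -- On `K` both `|f|` and `|Q|` are below `|c|`, so the sign of `c` alone decides every inequality;
  -- off `K` the functions agree.
  by_cases hx : x ∈ K
  · have h₁ := abs_le.mp (h₁ x hx)
    have h₂ := abs_le.mp (h₂ x hx)
    simp only [max_lt_iff, lt_abs] at hc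
    obtain ⟨-, hc₁, hc₂⟩ | ⟨-, hc₁, hc₂⟩ := hc
    · exact ⟨iff_of_true (by linarith) (by linarith), iff_of_true (by linarith) (by linarith)⟩
    · exact ⟨iff_of_false (by linarith) (by linarith), iff_of_false (by linarith) (by linarith)⟩
  · simp [hfK x hx]

end ReferenceForm

/-! ### Comparison of open and closed sublevel sets -/

/-- The strict sublevel set `{x | f x < c}`. -/
def strictSublevel {X : Type} (f : X → ℝ) (c : ℝ) : Set X := {x | f x < c}

lemma strictSublevel_mono {X : Type} (f : X → ℝ) {a b : ℝ} (h : a ≤ b) :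
    strictSublevel f a ⊆ strictSublevel f b :=
  fun _ hx => lt_of_lt_of_le hx h

lemma strictSublevel_subset_sublevel {X : Type} (f : X → ℝ) (a : ℝ) :
    strictSublevel f a ⊆ sublevel f a :=
  fun _ hx => le_of_lt (α := ℝ) hx

lemma sublevel_subset_strictSublevel {X : Type} (f : X → ℝ) {a b : ℝ} (h : a < b) :
    sublevel f a ⊆ strictSublevel f b :=
  fun _ hx => lt_of_le_of_lt hx h

lemma compl_sublevel_eq {X : Type} (f : X → ℝ) (c : ℝ) :
    (sublevel f c)ᶜ = strictSublevel (-f) (-c) := by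
  ext x
  simp [sublevel, strictSublevel]

/-- The analogue of `iMap` for strict sublevel sets. -/
noncomputable def iMapStrict (R : Type u) [Ring R] (k : ℕ) {X : Type} [TopologicalSpace X]
    (f : X → ℝ) {c N : ℝ} (h₁ : -N ≤ c) (h₂ : c ≤ N) :
    (relHomology R k).obj (setPair (strictSublevel_mono f h₁)) →ₗ[R]
      (relHomology R k).obj (setPair (strictSublevel_mono f (h₁.trans h₂))) :=
  inclHomology R k _ _ (strictSublevel_mono f h₂) subset_rfl

lemma surjective_jMap_iff (R : Type u) [Ring R] (k : ℕ) {X : Type} [TopologicalSpace X]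
    (f : X → ℝ) {c c' N : ℝ} (hc : -c = c') (h₁ : -N ≤ c) (h₂ : c ≤ N) (h₁' : -N ≤ c')
    (h₂' : c' ≤ N) :
    Function.Surjective (jMap R k f h₁ h₂) ↔
      Function.Surjective (iMapStrict R k (-f) h₁' h₂') := by
  subst hc
  exact surjective_inclHomology_congr R k _ _ _ _ _ _ _ _ (compl_sublevel_eq f c)
    (compl_sublevel_eq f N) ((compl_sublevel_eq f (-N)).trans (by rw [neg_neg]))
    (compl_sublevel_eq f N)

section Comparison

variable {n : ℕ} {f : EuclideanSpace ℝ (Fin n) → ℝ} (R : Type u) [Ring R] (k : ℕ)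

/-- In the square of inclusions from open to closed pairs, the map between the targets is an
isomorphism, so a surjection on the open side forces one on the closed side. -/
lemma QuadraticAtInfinity.eventually_surjective_iMap_of_strict (hf : QuadraticAtInfinity f)
    (c : ℝ) : ∀ᶠ N : ℝ in Filter.atTop, ∀ (h₁ : -N ≤ c) (h₂ : c ≤ N),
      Function.Surjective (iMapStrict R k f h₁ h₂) → Function.Surjective (iMap R k f h₁ h₂) := by
  obtain ⟨hc, Q, hQ⟩ := hf
  obtain ⟨M, hM₀, hM⟩ := hQ.exists_level hc
  filter_upwards [Filter.eventually_gt_atTop M] with N hN h₁ h₂ hs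
  have hN₀ : 0 < N := hM₀.trans_lt hN
  have hp := hM N (by rwa [abs_of_pos hN₀])
  have hn := hM (-N) (by rwa [abs_neg, abs_of_pos hN₀])
  have hb := bijective_inclHomology_of_quadraticForm R k Q
    (strictSublevel_mono f (h₁.trans h₂)) (sublevel_mono f (h₁.trans h₂))
    (strictSublevel_subset_sublevel f N) (strictSublevel_subset_sublevel f (-N))
    (fun x y hxy hx => (hp y).2.mpr (hxy.trans_lt ((hp x).2.mp hx)))
    (fun x y hxy hx => (hn y).2.mpr (hxy.trans_lt ((hn x).2.mp hx)))
    (fun x y hxy hx => (hp y).1.mpr (hxy.trans ((hp x).1.mp hx)))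
    (fun x y hxy hx => (hn y).1.mpr (hxy.trans ((hn x).1.mp hx)))
    hN₀ (fun x hx => (hp x).2.mpr hx) hN₀ (fun x hx => (hn x).1.mp hx)
    (M := N + 1) (fun x hx => (hn x).2.mpr (by linarith))
  intro z
  obtain ⟨y, rfl⟩ := hb.2 z
  obtain ⟨x, rfl⟩ := hs y
  refine ⟨inclHomology R k (strictSublevel_mono f h₁) (sublevel_mono f h₁)
    (strictSublevel_subset_sublevel f c) (strictSublevel_subset_sublevel f (-N)) x, ?_⟩
  simp only [iMap, iMapStrict, inclHomology_comp]

/-- The closed target `(f^{N+1}, f^{-(N+1)})` and the open target `({f < N}, {f < -N})` are not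
nested, so both are compared inside `({f < N+2}, {f < -N})`, where each inclusion is an isomorphism.
-/
lemma QuadraticAtInfinity.eventually_surjective_iMapStrict (hf : QuadraticAtInfinity f)
    {c c' : ℝ} (hcc' : c < c')
    (hs : ∀ᶠ N : ℝ in Filter.atTop, ∃ (h₁ : -N ≤ c) (h₂ : c ≤ N),
      Function.Surjective (iMap R k f h₁ h₂)) :
    ∀ᶠ N : ℝ in Filter.atTop, ∃ (h₁ : -N ≤ c') (h₂ : c' ≤ N),
      Function.Surjective (iMapStrict R k f h₁ h₂) := by
  obtain ⟨hc, Q, hQ⟩ := hf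
  obtain ⟨M, hM₀, hM⟩ := hQ.exists_level hc
  obtain ⟨N₀, hN₀⟩ := Filter.eventually_atTop.mp hs
  filter_upwards [Filter.eventually_gt_atTop M, Filter.eventually_ge_atTop N₀,
    Filter.eventually_ge_atTop c', Filter.eventually_ge_atTop (-c')] with N hN hNN₀ hNc hNc'
  have h₁' : -N ≤ c' := by linarith
  refine ⟨h₁', hNc, ?_⟩
  -- The shift to `N + 1` puts the closed lower set `f^{-(N+1)}` inside the open one `{f < -N}`.
  obtain ⟨h₁, h₂, hs⟩ := hN₀ (N + 1) (by linarith)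
  have hpos : 0 < N := hM₀.trans_lt hN
  have level {a : ℝ} (ha : N ≤ a) := hM a (by rw [abs_of_pos (by linarith)]; linarith)
  have levelNeg {a : ℝ} (ha : N ≤ a) :=
    hM (-a) (by rw [abs_neg, abs_of_pos (by linarith)]; linarith)
  have hp := level le_rfl
  have hp₁ := level (a := N + 1) (by linarith)
  have hp₂ := level (a := N + 2) (by linarith)
  have hn := levelNeg le_rfl
  have hn₁ := levelNeg (a := N + 1) (by linarith)
  have hsub : -N ≤ N + 2 := by linarith
  have hb₁ := bijective_inclHomology_of_quadraticForm R k Q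
    (sublevel_mono f (h₁.trans h₂)) (strictSublevel_mono f hsub)
    (sublevel_subset_strictSublevel f (by linarith))
    (sublevel_subset_strictSublevel f (by linarith))
    (fun x y hxy hx => (hp₁ y).1.mpr (hxy.trans ((hp₁ x).1.mp hx)))
    (fun x y hxy hx => (hn₁ y).1.mpr (hxy.trans ((hn₁ x).1.mp hx)))
    (fun x y hxy hx => (hp₂ y).2.mpr (hxy.trans_lt ((hp₂ x).2.mp hx)))
    (fun x y hxy hx => (hn y).2.mpr (hxy.trans_lt ((hn x).2.mp hx)))
    hpos (fun x hx => (hp₁ x).1.mpr (by linarith)) hpos (fun x hx => ((hn x).2.mp hx).le)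
    (M := N + 1) (fun x hx => (hn₁ x).1.mpr hx)
  have hb₂ := bijective_inclHomology_of_quadraticForm R k Q
    (strictSublevel_mono f (h₁'.trans hNc)) (strictSublevel_mono f hsub)
    (strictSublevel_mono f (by linarith)) subset_rfl
    (fun x y hxy hx => (hp y).2.mpr (hxy.trans_lt ((hp x).2.mp hx)))
    (fun x y hxy hx => (hn y).2.mpr (hxy.trans_lt ((hn x).2.mp hx)))
    (fun x y hxy hx => (hp₂ y).2.mpr (hxy.trans_lt ((hp₂ x).2.mp hx)))
    (fun x y hxy hx => (hn y).2.mpr (hxy.trans_lt ((hn x).2.mp hx)))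
    hpos (fun x hx => (hp x).2.mpr hx) hpos (fun x hx => ((hn x).2.mp hx).le)
    (M := N + 1) (fun x hx => (hn x).2.mpr (by linarith))
  intro z
  obtain ⟨y, hy⟩ := hb₁.2 (inclHomology R k (strictSublevel_mono f (h₁'.trans hNc))
    (strictSublevel_mono f hsub) (strictSublevel_mono f (by linarith)) subset_rfl z)
  obtain ⟨x, rfl⟩ := hs y
  -- The image of the closed preimage hits `z` because the two agree in the common larger pair, into
  -- which `hb₂` is injective.
  refine ⟨inclHomology R k (sublevel_mono f h₁) (strictSublevel_mono f h₁')
    (sublevel_subset_strictSublevel f hcc') (sublevel_subset_strictSublevel f (by linarith)) x,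
    hb₂.1 ?_⟩
  rw [← hy]
  simp only [iMap, iMapStrict, inclHomology_comp]

end Comparison

end MinMax

/-! ### Minmax and maxmin under negation -/

theorem lemma2p9 {n : ℕ} (R : Type u) [Ring R] (f : EuclideanSpace ℝ (Fin n) → ℝ)
    (hlip : LocallyLipschitz f) (hquad : MinMax.QuadraticAtInfinity f) :
    MinMax.maxmin f R = -MinMax.minmax (-f) R := by
  obtain ⟨hf, Q, hQ⟩ := hquad
  have hneg : MinMax.QuadraticAtInfinity (-f) := ⟨hf.neg, -Q, hQ.neg⟩
  rw [MinMax.maxmin, MinMax.minmax, hQ.indexAtInfinity_neg]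
  apply le_antisymm
  · refine sSup_le ?_
    rintro _ ⟨c, hc, rfl⟩
    refine EReal.le_neg_of_le_neg (sInf_le ⟨-c, ?_, EReal.coe_neg c⟩)
    filter_upwards [hc, hneg.eventually_surjective_iMap_of_strict R _ (-c)]
    rintro N ⟨h₁, h₂, hs⟩ H
    exact ⟨neg_le_neg h₂, neg_le.mp h₁,
      H _ _ ((MinMax.surjective_jMap_iff R _ f rfl h₁ h₂ _ _).mp hs)⟩
  · refine EReal.neg_le_of_neg_le (le_sInf ?_)
    rintro _ ⟨c, hc, rfl⟩
    -- Passing from closed to open sublevel sets costs an arbitrarily small increase of level, which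
    -- the bound does not see.
    refine EReal.le_of_forall_lt_iff_le.mp fun c' hcc' => ?_
    refine EReal.neg_le_of_neg_le (le_sSup ⟨-c', ?_, EReal.coe_neg c'⟩)
    filter_upwards [hneg.eventually_surjective_iMapStrict R _ (EReal.coe_lt_coe_iff.mp hcc') hc]
    rintro N ⟨h₁, h₂, hs⟩
    exact ⟨neg_le_neg h₂, neg_le.mp h₁,
      (MinMax.surjective_jMap_iff R _ f (neg_neg c') _ _ h₁ h₂).mpr hs⟩
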